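/- Let $F$ be an algebraically closed field (of any characteristic) and let $L$ be a finite-dimensional (right) Leibniz algebra over $F$, that is, a finite-dimensional vector space with a bilinear product $[\cdot,\cdot]$ such that $[x,[y,z]]=[[x,y],z]-[[x,z],y]$ for all $x,y,z\in L$. Put $L^{(0)}=L$ and $L^{(k+1)}=[L^{(k)},L^{(k)}]$ for $k\ge 0$, and call $L$ solvable if $L^{(n)}=0$ for some $n$; the least such $n$ is then the derived length of $L$. An algebra $S$ is called nilpotent if $S^{k}=0$ for some $k\ge 1$, where $S^1=S$ and $S^{k+1}=[S^k,S]$, and abelian if $[S,S]=0$. Suppose that $L$ is solvable and that $L$ is an $A$-algebra, meaning that every nilpotent subalgebra of $L$ is abelian. Then the derived length of $L$ is at most $3$. -/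

import Mathlib

/-!
Algebras here are non-unital, non-associative algebras over a field `F`: a type `L` with
`[NonUnitalNonAssocRing L] [Module F L] [IsScalarTower F L L] [SMulCommClass F L L]`, so that the
multiplication is `F`-bilinear. The bracket `[x, y]` is written `x * y`, and subalgebras are
Mathlib's `NonUnitalSubalgebra F L`.
-/

namespace LeibnizAlgebra

/-- The (right) Leibniz identity `[x, [y, z]] = [[x, y], z] - [[x, z], y]`, that is, every right
multiplication is a derivation. -/
def IsLeibniz (L : Type*) [NonUnitalNonAssocRing L] : Prop :=
  ∀ x y z : L, x * (y * z) = (x * y) * z - (x * z) * y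

section Series

variable (F : Type*) (L : Type*) [Field F] [NonUnitalNonAssocRing L] [Module F L]
  [IsScalarTower F L L] [SMulCommClass F L L]

/-- `[U, V]`: the subspace spanned by all the products `u * v` with `u ∈ U` and `v ∈ V`. -/
def bracket {F : Type*} {L : Type*} [Field F] [NonUnitalNonAssocRing L] [Module F L]
    (U V : Submodule F L) : Submodule F L :=
  Submodule.span F {x | ∃ u ∈ U, ∃ v ∈ V, u * v = x}

/-- The lower central series, counted from `0`: the `k`-th term is `L^{k+1}`, where `L^1 = L` and
`L^{k+1} = [L^k, L]`. -/
def lowerCentralSeries : ℕ → Submodule F L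
  | 0 => ⊤
  | k + 1 => bracket (lowerCentralSeries k) ⊤

/-- The derived series `L^{(0)} = L`, `L^{(k+1)} = [L^{(k)}, L^{(k)}]`. -/
def derivedSeries : ℕ → Submodule F L
  | 0 => ⊤
  | k + 1 => bracket (derivedSeries k) (derivedSeries k)

/-- `L` is nilpotent if its lower central series reaches `0`. -/
def IsNilpotent : Prop := ∃ k : ℕ, lowerCentralSeries F L k = ⊥

/-- `L` is solvable if its derived series reaches `0`. -/
def IsSolvable : Prop := ∃ k : ℕ, derivedSeries F L k = ⊥

/-- The derived length of a solvable algebra: the least `n` with `L^{(n)} = 0`. (It is only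
meaningful when `L` is solvable.) -/
noncomputable def derivedLength : ℕ := sInf {n : ℕ | derivedSeries F L n = ⊥}

/-- `L` is an `A`-algebra if every subalgebra that is nilpotent (as an algebra in its own right)
is abelian, i.e. has zero multiplication. -/
def IsAAlgebra : Prop :=
  ∀ S : NonUnitalSubalgebra F L, IsNilpotent F S → ∀ x ∈ S, ∀ y ∈ S, x * y = 0

end Series

end LeibnizAlgebra

/-! It suffices that `L^{(2)}` annihilates every chief factor `U / V` from the right. Its elements
then act nilpotently on `L`, so by Engel's theorem `L^{(2)}` is nilpotent, hence abelian, and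
`L^{(3)} = 0`.

Let `K` be the right annihilator of `U / V` and `N ⊇ K` an ideal maximal subject to `[N, N] ⊆ K`. An
element of `N` singular on `U / V` acts nilpotently there by irreducibility, hence trivially by the
`A`-property. Over an algebraically closed field every pencil of operators has a singular member, so
`dim N / K ≤ 1`. Thus `L` acts on `N / K` by scalars, and `[L, L]` lies in the centralizer `C` of `N
/ K`. If `C ≠ N`, a chief factor `D / N` below `C` makes `D / K` nilpotent, hence abelian, against
the choice of `N`. So `L^{(1)} ⊆ N` and `L^{(2)} ⊆ K`.

The `A`-property passes to sections by `IsAAlgebra.mul_mem_of_engel`, a minimal-supplement argument.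
-/

namespace LeibnizAlgebra

/-! ### Engel's theorem -/

section Engel

attribute [local instance] LieRing.ofAssociativeRing

variable {F L : Type*} [Field F] [NonUnitalNonAssocRing L] [Module F L]
  [IsScalarTower F L L] [SMulCommClass F L L]

theorem IsLeibniz.mul_mul_right (h : IsLeibniz L) (a b x : L) :
    (a * b) * x = (a * x) * b + a * (b * x) := by
  rw [h a b x]; abel

/-- The right multiplications of a Leibniz algebra form a Lie algebra of endomorphisms. -/
def rightMulLieSubalgebra (F : Type*) {L : Type*} [Field F] [NonUnitalNonAssocRing L] [Module F L]
    [IsScalarTower F L L] [SMulCommClass F L L] (h : IsLeibniz L) :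
    LieSubalgebra F (Module.End F L) where
  __ := LinearMap.range (LinearMap.mul F L).flip
  lie_mem' := by
    rintro _ _ ⟨x, rfl⟩ ⟨y, rfl⟩
    refine ⟨y * x, ?_⟩
    ext z
    simp [LieRing.of_associative_ring_bracket, h z y x]

/-- Engel's theorem for Leibniz algebras. -/
theorem isNilpotent_of_forall_mulRight_pow_eq_zero [FiniteDimensional F L] (h : IsLeibniz L)
    (hn : ∀ x y : L, ∃ n : ℕ, (LinearMap.mulRight F x ^ n) y = 0) : IsNilpotent F L := by
  -- Engel's theorem for Lie algebras, applied to the right multiplications acting on `L`.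
  have hG : LieModule.IsNilpotent (rightMulLieSubalgebra F h) L := by
    apply LieAlgebra.isEngelian_of_isNoetherian (R := F) (L := rightMulLieSubalgebra F h)
    rintro ⟨_, x, rfl⟩
    rw [Module.End.isNilpotent_iff_of_finite]
    exact hn x
  obtain ⟨k, hk⟩ := (LieModule.isNilpotent_iff F (rightMulLieSubalgebra F h) L).1 hG
  have key : ∀ k, lowerCentralSeries F L k ≤
      (LieModule.lowerCentralSeries F (rightMulLieSubalgebra F h) L k).toSubmodule := by
    intro k
    induction k with
    | zero => simp
    | succ k ih =>
      refine Submodule.span_le.2 ?_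
      rintro _ ⟨u, hu, v, -, rfl⟩
      rw [LieModule.lowerCentralSeries_succ]
      exact LieSubmodule.lie_mem_lie (x := ⟨_, v, rfl⟩) (LieSubmodule.mem_top _) (ih hu)
  refine ⟨k, eq_bot_iff.2 ((key k).trans ?_)⟩
  rw [hk]; simp

theorem IsAAlgebra.mul_eq_zero [FiniteDimensional F L] (hL : IsLeibniz L) (hA : IsAAlgebra F L)
    {S : Submodule F L} (hS : ∀ x ∈ S, ∀ y ∈ S, x * y ∈ S)
    (hn : ∀ x ∈ S, ∀ y ∈ S, ∃ n : ℕ, (LinearMap.mulRight F x ^ n) y = 0) :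
    ∀ x ∈ S, ∀ y ∈ S, x * y = 0 := by
  let T : NonUnitalSubalgebra F L :=
    { S with mul_mem' := fun {a b} ha hb => hS a ha b hb }
  have : FiniteDimensional F T := inferInstanceAs (FiniteDimensional F S)
  have hT : IsLeibniz T := fun x y z => Subtype.ext (hL x y z)
  refine hA T (isNilpotent_of_forall_mulRight_pow_eq_zero hT fun x y => ?_)
  obtain ⟨n, hn⟩ := hn x x.2 y y.2
  refine ⟨n, Subtype.ext ?_⟩
  have key : ∀ n : ℕ, ∀ y : T, (((LinearMap.mulRight F x ^ n) y : T) : L) =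
      (LinearMap.mulRight F (x : L) ^ n) (y : L) := by
    intro n
    induction n with
    | zero => simp
    | succ n ih => intro y; rw [pow_succ, pow_succ]; exact ih (y * x)
  rw [key, hn]; rfl

end Engel

/-! ### Fitting null components and pencils of operators -/

section Fitting

variable {F E : Type*} [Field F] [AddCommGroup E] [Module F E]

theorem pow_apply_mem {f : Module.End F E} {J : Submodule F E} (hJ : ∀ x ∈ J, f x ∈ J) (n : ℕ)
    {x : E} (hx : x ∈ J) : (f ^ n) x ∈ J := by
  induction n with
  | zero => simpa
  | succ n ih => rw [pow_succ']; exact hJ _ ih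

theorem pow_apply_mem_of_le {f : Module.End F E} {J : Submodule F E} (hJ : ∀ x ∈ J, f x ∈ J)
    {n m : ℕ} (hnm : n ≤ m) {x : E} (hx : (f ^ n) x ∈ J) : (f ^ m) x ∈ J := by
  obtain ⟨k, rfl⟩ := Nat.exists_eq_add_of_le' hnm
  rw [pow_add]; exact pow_apply_mem hJ k hx

theorem pow_apply_eq_zero_of_le {f : Module.End F E} {n m : ℕ} (hnm : n ≤ m) {x : E}
    (hx : (f ^ n) x = 0) : (f ^ m) x = 0 :=
  (Submodule.mem_bot F).1 (pow_apply_mem_of_le (J := ⊥) (by simp) hnm (by simpa using hx))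

variable [FiniteDimensional F E]

/-- A vector sent into an invariant subspace `J` by a power of `f` is congruent modulo `J` to a
vector in the Fitting null component of `f`. -/
theorem exists_sub_mem_ker_pow {f : Module.End F E} {J : Submodule F E} (hJ : ∀ x ∈ J, f x ∈ J)
    {n : ℕ} {p : E} (hp : (f ^ n) p ∈ J) : ∃ j ∈ J, ∃ m : ℕ, (f ^ m) (p - j) = 0 := by
  -- Once the images of `J` stabilize, `f ^ m (f ^ n p)` equals `f ^ (m + n) j` for some `j ∈ J`.
  have hanti : Antitone fun m : ℕ => J.map (f ^ m) := by
    refine antitone_nat_of_succ_le fun m => ?_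
    rintro _ ⟨x, hx, rfl⟩
    exact ⟨f x, hJ x hx, by rw [pow_succ]; rfl⟩
  obtain ⟨m, hm⟩ := IsArtinian.monotone_stabilizes
    (⟨fun m => OrderDual.toDual (J.map (f ^ m)), hanti⟩ : ℕ →o (Submodule F E)ᵒᵈ)
  have hmn : J.map (f ^ m) = J.map (f ^ (m + n)) := hm (m + n) (Nat.le_add_right _ _)
  obtain ⟨j, hj, hjm⟩ : (f ^ m) ((f ^ n) p) ∈ J.map (f ^ (m + n)) := by
    rw [← hmn]; exact ⟨_, hp, rfl⟩
  refine ⟨j, hj, m + n, ?_⟩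
  rw [map_sub, hjm, pow_add]
  exact sub_self _

/-- If `g` is injective on a nonzero quotient `U / V`, the pencil `f - c g` is singular on it for
some `c`. -/
theorem exists_sub_smul_mem [IsAlgClosed F] {U V : Submodule F E} (hVU : V < U)
    {f g : Module.End F E} (hfU : ∀ u ∈ U, f u ∈ U) (hfV : ∀ u ∈ V, f u ∈ V)
    (hgU : ∀ u ∈ U, g u ∈ U) (hgV : ∀ u ∈ V, g u ∈ V)
    (hg : ∀ u ∈ U, g u ∈ V → u ∈ V) :
    ∃ c : F, ∃ u ∈ U, u ∉ V ∧ f u - c • g u ∈ V := by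
  let V' : Submodule F U := V.comap U.subtype
  let f' : Module.End F (U ⧸ V') := V'.mapQ V' (f.restrict hfU) fun u hu => hfV u hu
  let g' : Module.End F (U ⧸ V') := V'.mapQ V' (g.restrict hgU) fun u hu => hgV u hu
  have hinj : Function.Injective g' := by
    rw [injective_iff_map_eq_zero]
    intro a
    obtain ⟨u, rfl⟩ := V'.mkQ_surjective a
    intro h
    have h1 : V'.mkQ (g.restrict hgU u) = 0 := h
    rw [Submodule.mkQ_apply, Submodule.Quotient.mk_eq_zero] at h1 ⊢
    exact hg u u.2 h1
  have : Nontrivial (U ⧸ V') := by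
    rw [Submodule.Quotient.nontrivial_iff]
    intro htop
    obtain ⟨u, hu, huV⟩ := SetLike.exists_of_lt hVU
    have : (⟨u, hu⟩ : U) ∈ V' := htop ▸ Submodule.mem_top
    exact huV this
  let e := LinearEquiv.ofInjectiveEndo g' hinj
  -- The required `c` is an eigenvalue of `g'⁻¹ f'`.
  obtain ⟨c, hc⟩ := Module.End.exists_eigenvalue ((e.symm : (U ⧸ V') →ₗ[F] (U ⧸ V')) ∘ₗ f')
  obtain ⟨a, ha⟩ := hc.exists_hasEigenvector
  have h1 : f' a = c • g' a := by
    have h2 : e.symm (f' a) = c • a := ha.apply_eq_smul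
    have h3 := congrArg e h2
    rw [e.apply_symm_apply, map_smul] at h3
    exact h3
  obtain ⟨u, rfl⟩ := V'.mkQ_surjective a
  refine ⟨c, u, u.2, fun huV => ha.2 ?_, ?_⟩
  · rw [Submodule.mkQ_apply, Submodule.Quotient.mk_eq_zero]; exact huV
  · have h2 : V'.mkQ (f.restrict hfU u) = V'.mkQ (c • g.restrict hgU u) := by
      rw [map_smul]; exact h1
    have h3 := (Submodule.Quotient.eq V').1 h2
    exact h3

end Fitting

/-! ### The `A`-property on sections -/

section Quotient

variable {F L : Type*} [Field F] [NonUnitalNonAssocRing L] [Module F L]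
  [IsScalarTower F L L]

/-- Right multiplication by `x` is a derivation, so its Fitting null component is a subalgebra. -/
theorem exists_mulRight_pow_mul_eq_zero (hL : IsLeibniz L) (x : L) (n m : ℕ) (a b : L)
    (ha : (LinearMap.mulRight F x ^ n) a = 0) (hb : (LinearMap.mulRight F x ^ m) b = 0) :
    ∃ k : ℕ, (LinearMap.mulRight F x ^ k) (a * b) = 0 := by
  induction hN : n + m generalizing n m a b with
  | zero =>
    obtain rfl : n = 0 := by omega
    exact ⟨0, by simp_all⟩
  | succ N ih =>
    rcases n with _ | n
    · exact ⟨0, by simp_all⟩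
    rcases m with _ | m
    · exact ⟨0, by simp_all⟩
    obtain ⟨k, hk⟩ := ih n (m + 1) (a * x) b (by rw [pow_succ] at ha; exact ha) hb (by omega)
    obtain ⟨l, hl⟩ := ih (n + 1) m a (b * x) ha (by rw [pow_succ] at hb; exact hb) (by omega)
    refine ⟨max k l + 1, ?_⟩
    rw [pow_succ, Module.End.mul_apply, LinearMap.mulRight_apply, hL.mul_mul_right, map_add,
      pow_apply_eq_zero_of_le (le_max_left k l) hk, pow_apply_eq_zero_of_le (le_max_right k l) hl,
      add_zero]

variable [SMulCommClass F L L] [FiniteDimensional F L]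

/-- In an `A`-algebra, sections satisfying the Engel condition are abelian. -/
theorem IsAAlgebra.mul_mem_of_engel (hL : IsLeibniz L) (hA : IsAAlgebra F L)
    {S I : Submodule F L} (hS : ∀ x ∈ S, ∀ y ∈ S, x * y ∈ S)
    (hIr : ∀ x ∈ I, ∀ y ∈ S, x * y ∈ I) (hIl : ∀ x ∈ S, ∀ y ∈ I, x * y ∈ I)
    (hn : ∀ x ∈ S, ∀ y ∈ S, ∃ n : ℕ, (LinearMap.mulRight F x ^ n) y ∈ I) :
    ∀ x ∈ S, ∀ y ∈ S, x * y ∈ I := by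
  -- `K` is a minimal subalgebra of `S` supplementing `I`. For `x ∈ K`, the null component `K₀` of
  -- `x` in `K` still supplements `I`, so `K₀ = K` and `K` is abelian by Engel.
  obtain ⟨K, ⟨hKS, hK, hKI⟩, hmin⟩ := exists_minimal_of_wellFoundedLT
    (fun K : Submodule F L => K ≤ S ∧ (∀ x ∈ K, ∀ y ∈ K, x * y ∈ K) ∧ S ≤ K ⊔ I)
    ⟨S, le_rfl, hS, le_sup_left⟩
  have hzero : ∀ x ∈ K, ∀ y ∈ K, x * y = 0 := by
    refine hA.mul_eq_zero hL hK fun x hx y hy => ?_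
    let K₀ : Submodule F L :=
      { carrier := {z | z ∈ K ∧ ∃ n : ℕ, (LinearMap.mulRight F x ^ n) z = 0}
        zero_mem' := ⟨zero_mem _, 0, by simp⟩
        add_mem' := by
          rintro a b ⟨ha, n, hn⟩ ⟨hb, m, hm⟩
          refine ⟨add_mem ha hb, max n m, ?_⟩
          rw [map_add, pow_apply_eq_zero_of_le (le_max_left n m) hn,
            pow_apply_eq_zero_of_le (le_max_right n m) hm, add_zero]
        smul_mem' := by
          rintro c a ⟨ha, n, hn⟩
          exact ⟨K.smul_mem c ha, n, by rw [map_smul, hn, smul_zero]⟩ }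
    have hle : K ≤ K₀ := by
      refine hmin ⟨fun z hz => hKS hz.1, ?_, ?_⟩ fun z hz => hz.1
      · rintro a ⟨ha, n, hn⟩ b ⟨hb, m, hm⟩
        exact ⟨hK a ha b hb, exists_mulRight_pow_mul_eq_zero hL x n m a b hn hm⟩
      · refine hKI.trans (sup_le (fun z hz => ?_) le_sup_right)
        obtain ⟨n, hnz⟩ := hn x (hKS hx) z (hKS hz)
        obtain ⟨j, hj, m, hm⟩ := exists_sub_mem_ker_pow (f := LinearMap.mulRight F x) (J := K ⊓ I)
          (fun a ha => ⟨hK a ha.1 x hx, hIr a ha.2 x (hKS hx)⟩) (n := n) (p := z)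
          ⟨pow_apply_mem (fun a ha => hK a ha x hx) n hz, hnz⟩
        exact Submodule.mem_sup.2 ⟨z - j, ⟨sub_mem hz hj.1, m, hm⟩, j, hj.2, by simp⟩
    exact (hle hy).2
  intro x hx y hy
  obtain ⟨a, ha, i, hi, rfl⟩ := Submodule.mem_sup.1 (hKI hx)
  obtain ⟨b, hb, j, hj, rfl⟩ := Submodule.mem_sup.1 (hKI hy)
  rw [mul_add, add_mul, hzero a ha b hb, zero_add]
  exact add_mem (hIr i hi b (hKS hb)) (hIl _ hx j hj)

/-- In an `A`-algebra every right multiplication is that of an element of square zero. -/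
theorem IsAAlgebra.exists_mul_self_eq_zero (hL : IsLeibniz L) (hA : IsAAlgebra F L) (b : L) :
    ∃ b₀ : L, b₀ * b₀ = 0 ∧ ∀ y : L, y * b₀ = y * b := by
  let J : Submodule F L :=
    { carrier := {c | ∀ y : L, y * c = 0}
      zero_mem' := fun y => mul_zero y
      add_mem' := fun {c d} hc hd y => by rw [mul_add, hc, hd, add_zero]
      smul_mem' := fun a c hc y => by rw [mul_smul_comm, hc, smul_zero] }
  have hJb : ∀ c ∈ J, ∀ d : L, c * d ∈ J := fun c hc d y => by
    rw [hL y c d, hc y, hc (y * d), zero_mul, sub_zero]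
  have hbb : b * b ∈ J := fun y => by rw [hL y b b, sub_self]
  obtain ⟨c, hc, m, hm⟩ := exists_sub_mem_ker_pow (f := LinearMap.mulRight F b) (J := J)
    (fun a ha => hJb a ha b) (n := 1) (p := b) (by simpa using hbb)
  have hR : ∀ y : L, y * (b - c) = y * b := fun y => by rw [mul_sub, hc y, sub_zero]
  refine ⟨b - c, ?_, hR⟩
  -- The null component of `b` in `F b + J`; each element acts from the right as a multiple of `b`.
  let S : Submodule F L :=
    { carrier := {z | (∃ r : F, z - r • b ∈ J) ∧ ∃ n : ℕ, (LinearMap.mulRight F b ^ n) z = 0}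
      zero_mem' := ⟨⟨0, by simp⟩, 0, by simp⟩
      add_mem' := by
        rintro z w ⟨⟨r, hr⟩, n, hn⟩ ⟨⟨s, hs⟩, k, hk⟩
        refine ⟨⟨r + s, ?_⟩, max n k, ?_⟩
        · have := add_mem hr hs
          rwa [sub_add_sub_comm, ← add_smul] at this
        · rw [map_add, pow_apply_eq_zero_of_le (le_max_left n k) hn,
            pow_apply_eq_zero_of_le (le_max_right n k) hk, add_zero]
      smul_mem' := by
        rintro t z ⟨⟨r, hr⟩, n, hn⟩
        refine ⟨⟨t * r, ?_⟩, n, by rw [map_smul, hn, smul_zero]⟩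
        rw [mul_smul, ← smul_sub]
        exact J.smul_mem t hr }
  have hSmul : ∀ z ∈ S, ∃ r : F, ∀ y : L, y * z = r • (y * b) := by
    rintro z ⟨⟨r, hr⟩, -⟩
    refine ⟨r, fun y => ?_⟩
    have := hr y
    rwa [mul_sub, mul_smul_comm, sub_eq_zero] at this
  have hSb : ∀ z ∈ S, z * b ∈ S := by
    rintro z ⟨⟨r, hr⟩, n, hn⟩
    refine ⟨⟨0, ?_⟩, n, ?_⟩
    · have h1 := add_mem (hJb _ hr b) (J.smul_mem r hbb)
      rw [sub_mul, smul_mul_assoc, sub_add_cancel] at h1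
      simpa using h1
    · have := pow_apply_eq_zero_of_le (Nat.le_succ n) hn
      rwa [pow_succ] at this
  have hb₀ : b - c ∈ S := ⟨⟨1, by simpa using hc⟩, m, hm⟩
  refine hA.mul_eq_zero hL (S := S) ?_ ?_ _ hb₀ _ hb₀
  · intro x hx y hy
    obtain ⟨r, hr⟩ := hSmul y hy
    rw [hr]
    exact S.smul_mem r (hSb x hx)
  · intro x hx y hy
    obtain ⟨r, hr⟩ := hSmul x hx
    obtain ⟨-, n, hn⟩ := hy
    refine ⟨n, ?_⟩
    have : LinearMap.mulRight F x = r • LinearMap.mulRight F b := by ext z; simp [hr]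
    rw [this, smul_pow, LinearMap.smul_apply, hn, smul_zero]

end Quotient

/-! ### Ideals and chief factors -/

section Ideals

variable {F L : Type*} [Field F] [NonUnitalNonAssocRing L] [Module F L]

/-- A subspace which is a two-sided ideal. -/
structure IsIdeal (I : Submodule F L) : Prop where
  mul_mem_right : ∀ x ∈ I, ∀ y : L, x * y ∈ I
  mul_mem_left : ∀ x : L, ∀ y ∈ I, x * y ∈ I

theorem mul_mem_bracket {U V : Submodule F L} {u v : L} (hu : u ∈ U) (hv : v ∈ V) :
    u * v ∈ bracket U V :=
  Submodule.subset_span ⟨u, hu, v, hv, rfl⟩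

theorem bracket_le {U V W : Submodule F L} :
    bracket U V ≤ W ↔ ∀ u ∈ U, ∀ v ∈ V, u * v ∈ W := by
  refine ⟨fun h u hu v hv => h (mul_mem_bracket hu hv), fun h => Submodule.span_le.2 ?_⟩
  rintro _ ⟨u, hu, v, hv, rfl⟩
  exact h u hu v hv

theorem IsIdeal.sup {I J : Submodule F L} (hI : IsIdeal I) (hJ : IsIdeal J) :
    IsIdeal (I ⊔ J) := by
  constructor
  · intro x hx y
    obtain ⟨a, ha, b, hb, rfl⟩ := Submodule.mem_sup.1 hx
    rw [add_mul]
    exact Submodule.add_mem_sup (hI.mul_mem_right a ha y) (hJ.mul_mem_right b hb y)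
  · intro x y hy
    obtain ⟨a, ha, b, hb, rfl⟩ := Submodule.mem_sup.1 hy
    rw [mul_add]
    exact Submodule.add_mem_sup (hI.mul_mem_left x a ha) (hJ.mul_mem_left x b hb)

/-- `U` covers `V` among the two-sided ideals: `U / V` is a chief factor. -/
structure IsChief (V U : Submodule F L) : Prop where
  bot_isIdeal : IsIdeal V
  top_isIdeal : IsIdeal U
  lt : V < U
  eq_or_eq : ∀ I : Submodule F L, IsIdeal I → V ≤ I → I ≤ U → I = V ∨ I = U

theorem exists_isChief_le [FiniteDimensional F L] {V C : Submodule F L} (hV : IsIdeal V)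
    (hC : IsIdeal C) (hVC : V < C) : ∃ U ≤ C, IsChief V U := by
  obtain ⟨U, ⟨hVU, hU, hUC⟩, hmin⟩ := exists_minimal_of_wellFoundedLT
    (fun U : Submodule F L => V < U ∧ IsIdeal U ∧ U ≤ C) ⟨C, hVC, hC, le_rfl⟩
  refine ⟨U, hUC, hV, hU, hVU, fun I hI hVI hIU => ?_⟩
  rcases hVI.eq_or_lt with h | h
  · exact Or.inl h.symm
  · exact Or.inr (le_antisymm hIU (hmin ⟨h, hI, hIU.trans hUC⟩ hIU))

variable [SMulCommClass F L L]

/-- The right annihilator of the section `U / V`. -/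
def rightAnnihilator (V U : Submodule F L) : Submodule F L where
  carrier := {x | ∀ u ∈ U, u * x ∈ V}
  zero_mem' := fun u _ => by rw [mul_zero]; exact zero_mem V
  add_mem' := fun {a b} ha hb u hu => by rw [mul_add]; exact add_mem (ha u hu) (hb u hu)
  smul_mem' := fun c a ha u hu => by rw [mul_smul_comm]; exact V.smul_mem c (ha u hu)

theorem isIdeal_rightAnnihilator (hL : IsLeibniz L) {V U : Submodule F L} (hV : IsIdeal V)
    (hU : IsIdeal U) : IsIdeal (rightAnnihilator V U) := by
  constructor
  · intro x hx y u hu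
    rw [hL]
    exact sub_mem (hV.mul_mem_right _ (hx u hu) y) (hx _ (hU.mul_mem_right u hu y))
  · intro y x hx u hu
    rw [hL]
    exact sub_mem (hx _ (hU.mul_mem_right u hu y)) (hV.mul_mem_right _ (hx u hu) y)

variable [IsScalarTower F L L]

theorem isIdeal_span {s : Set L} (hr : ∀ x ∈ s, ∀ y : L, x * y ∈ Submodule.span F s)
    (hl : ∀ x : L, ∀ y ∈ s, x * y ∈ Submodule.span F s) : IsIdeal (Submodule.span F s) := by
  constructor
  · intro x hx y
    have : Submodule.span F s ≤ (Submodule.span F s).comap (LinearMap.mulRight F y) :=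
      Submodule.span_le.2 fun x hx => hr x hx y
    exact this hx
  · intro x y hy
    have : Submodule.span F s ≤ (Submodule.span F s).comap (LinearMap.mulLeft F x) :=
      Submodule.span_le.2 fun y hy => hl x y hy
    exact this hy

theorem IsIdeal.bracket_self (hL : IsLeibniz L) {U : Submodule F L} (hU : IsIdeal U) :
    IsIdeal (bracket U U) := by
  apply isIdeal_span
  · rintro _ ⟨u, hu, v, hv, rfl⟩ y
    rw [hL.mul_mul_right]
    exact add_mem (mul_mem_bracket (hU.mul_mem_right u hu y) hv)
      (mul_mem_bracket hu (hU.mul_mem_right v hv y))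
  · rintro x _ ⟨u, hu, v, hv, rfl⟩
    rw [hL]
    exact sub_mem (mul_mem_bracket (hU.mul_mem_left x u hu) hv)
      (mul_mem_bracket (hU.mul_mem_left x v hv) hu)

theorem isIdeal_derivedSeries (hL : IsLeibniz L) (k : ℕ) : IsIdeal (derivedSeries F L k) := by
  induction k with
  | zero => exact ⟨fun _ _ _ => Submodule.mem_top, fun _ _ _ => Submodule.mem_top⟩
  | succ k ih => exact ih.bracket_self hL

/-- Otherwise `[U, U] + V = U`, and iterating gives `U ≤ L^{(k)} + V` for all `k`, against
solvability. -/
theorem IsChief.mul_mem (hL : IsLeibniz L) (hsol : IsSolvable F L) {V U : Submodule F L}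
    (h : IsChief V U) : ∀ x ∈ U, ∀ y ∈ U, x * y ∈ V := by
  rcases h.eq_or_eq _ ((h.top_isIdeal.bracket_self hL).sup h.bot_isIdeal) le_sup_right
    (sup_le (bracket_le.2 fun u hu v _ => h.top_isIdeal.mul_mem_right u hu v) h.lt.le) with h1 | h1
  · intro x hx y hy
    exact h1.le (Submodule.mem_sup_left (mul_mem_bracket hx hy))
  · obtain ⟨n, hn⟩ := hsol
    have key : ∀ k, U ≤ derivedSeries F L k ⊔ V := by
      intro k
      induction k with
      | zero => exact le_top.trans (le_sup_left (a := (⊤ : Submodule F L)))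
      | succ k ih =>
        rw [← h1]
        refine sup_le (bracket_le.2 fun u hu v hv => ?_) le_sup_right
        obtain ⟨a, ha, i, hi, rfl⟩ := Submodule.mem_sup.1 (ih hu)
        obtain ⟨b, hb, j, hj, rfl⟩ := Submodule.mem_sup.1 (ih hv)
        rw [add_mul, mul_add, add_assoc]
        exact Submodule.add_mem_sup (mul_mem_bracket ha hb)
          (add_mem (h.bot_isIdeal.mul_mem_left a j hj) (h.bot_isIdeal.mul_mem_right i hi _))
    exact absurd ((key n).trans (by simp [hn])) h.lt.not_ge

/-- A chief factor is irreducible under right multiplications. -/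
theorem IsChief.eq_or_eq_of_right (hL : IsLeibniz L) {V U E : Submodule F L} (h : IsChief V U)
    (hVE : V ≤ E) (hEU : E ≤ U) (hE : ∀ x ∈ E, ∀ y : L, x * y ∈ E) : E = V ∨ E = U := by
  -- The span of `s` is an ideal with `L * s = 0`. Modulo `V` it is either zero, so that left and
  -- right actions on `U` differ by a sign, or all of `U`, so that the left action vanishes.
  let s : Set L := {z | ∃ x : L, ∃ u ∈ U, x * u + u * x = z}
  have hs : ∀ x : L, ∀ z ∈ s, x * z = 0 := by
    rintro y _ ⟨x, u, hu, rfl⟩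
    rw [mul_add, hL, hL]; abel
  have hsI : IsIdeal (Submodule.span F s) := by
    apply isIdeal_span
    · rintro _ ⟨x, u, hu, rfl⟩ y
      have : (x * u + u * x) * y =
          ((x * y) * u + u * (x * y)) + (x * (u * y) + (u * y) * x) := by
        rw [add_mul, hL.mul_mul_right x, hL.mul_mul_right u]; abel
      rw [this]
      exact add_mem (Submodule.subset_span ⟨_, _, hu, rfl⟩)
        (Submodule.subset_span ⟨_, _, h.top_isIdeal.mul_mem_right u hu y, rfl⟩)
    · intro x z hz
      rw [hs x z hz]
      exact zero_mem _
  have hsU : Submodule.span F s ≤ U := by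
    refine Submodule.span_le.2 ?_
    rintro _ ⟨x, u, hu, rfl⟩
    exact add_mem (h.top_isIdeal.mul_mem_left x u hu) (h.top_isIdeal.mul_mem_right u hu x)
  refine h.eq_or_eq E ⟨hE, ?_⟩ hVE hEU
  rcases h.eq_or_eq _ (hsI.sup h.bot_isIdeal) le_sup_right (sup_le hsU h.lt.le) with h1 | h1
  · intro x e he
    have h2 : x * e + e * x ∈ V :=
      h1.le (Submodule.mem_sup_left (Submodule.subset_span ⟨x, e, hEU he, rfl⟩))
    have h3 := sub_mem (hVE h2) (hE e he x)
    rwa [add_sub_cancel_right] at h3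
  · intro x e he
    obtain ⟨a, ha, v, hv, rfl⟩ := Submodule.mem_sup.1 (h1.ge (hEU he))
    have h2 : Submodule.span F s ≤ LinearMap.ker (LinearMap.mulLeft F x) :=
      Submodule.span_le.2 fun z hz => hs x z hz
    have h3 : x * a = 0 := h2 ha
    rw [mul_add, h3, zero_add]
    exact hVE (h.bot_isIdeal.mul_mem_left x v hv)

end Ideals

/-! ### Action on chief factors and the bound -/

section Main

variable {F L : Type*} [Field F] [NonUnitalNonAssocRing L] [Module F L]
  [IsScalarTower F L L] [SMulCommClass F L L] [FiniteDimensional F L]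

/-- In an `A`-algebra, an element acting nilpotently on an abelian section annihilates it. -/
theorem IsAAlgebra.mem_rightAnnihilator (hL : IsLeibniz L) (hA : IsAAlgebra F L)
    {V U : Submodule F L} (hV : IsIdeal V) (hU : IsIdeal U)
    (hUU : ∀ x ∈ U, ∀ y ∈ U, x * y ∈ V) {b : L}
    (hb : ∀ u ∈ U, ∃ n : ℕ, (LinearMap.mulRight F b ^ n) u ∈ V) : b ∈ rightAnnihilator V U := by
  obtain ⟨b₀, hb₀, hR⟩ := hA.exists_mul_self_eq_zero hL b
  have hmul : ∀ x ∈ Submodule.span F {b₀} ⊔ U, ∀ y ∈ Submodule.span F {b₀} ⊔ U, x * y ∈ U := by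
    intro x hx y hy
    obtain ⟨a, ha, u, hu, rfl⟩ := Submodule.mem_sup.1 hx
    obtain ⟨c, hc, v, hv, rfl⟩ := Submodule.mem_sup.1 hy
    obtain ⟨r, rfl⟩ := Submodule.mem_span_singleton.1 ha
    obtain ⟨s, rfl⟩ := Submodule.mem_span_singleton.1 hc
    rw [mul_add, add_mul, smul_mul_smul_comm, hb₀, smul_zero, zero_add]
    exact add_mem (hU.mul_mem_right u hu _) (hU.mul_mem_left _ v hv)
  have key := hA.mul_mem_of_engel hL (S := Submodule.span F {b₀} ⊔ U) (I := V)
    (fun x hx y hy => Submodule.mem_sup_right (hmul x hx y hy))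
    (fun x hx y _ => hV.mul_mem_right x hx y) (fun x _ y hy => hV.mul_mem_left x y hy)
    ?_
  · intro u hu
    rw [← hR]
    exact key u (Submodule.mem_sup_right hu) b₀
      (Submodule.mem_sup_left (Submodule.mem_span_singleton_self b₀))
  · intro x hx y hy
    obtain ⟨n, hn⟩ := hb (y * x) (hmul y hy x hx)
    refine ⟨n + 1, ?_⟩
    obtain ⟨a, ha, v, hv, rfl⟩ := Submodule.mem_sup.1 hx
    obtain ⟨r, rfl⟩ := Submodule.mem_span_singleton.1 ha
    -- Since `U * U ⊆ V`, the element `r • b₀ + v` acts on `U / V` as `r • b`.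
    have hcong : ∀ k : ℕ, ∀ w ∈ U, ∃ t : F, (LinearMap.mulRight F (r • b₀ + v) ^ k) w -
        t • (LinearMap.mulRight F b ^ k) w ∈ V := by
      intro k
      induction k with
      | zero => exact fun w _ => ⟨1, by simp⟩
      | succ k ih =>
        intro w hw
        obtain ⟨t, ht⟩ := ih w hw
        refine ⟨r * t, ?_⟩
        have hU' : (LinearMap.mulRight F (r • b₀ + v) ^ k) w ∈ U :=
          pow_apply_mem (fun z hz => hU.mul_mem_right z hz _) k hw
        have h1 := add_mem (V.smul_mem r (hV.mul_mem_right _ ht b)) (hUU _ hU' v hv)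
        rw [pow_succ', pow_succ', Module.End.mul_apply, Module.End.mul_apply,
          LinearMap.mulRight_apply, LinearMap.mulRight_apply, mul_add, mul_smul_comm, hR, mul_smul]
        rw [sub_mul, smul_sub, smul_mul_assoc] at h1
        convert h1 using 1
        abel
    obtain ⟨t, ht⟩ := hcong n _ (hmul y hy _ hx)
    have h2 := add_mem ht (V.smul_mem t hn)
    rw [sub_add_cancel] at h2
    rw [pow_succ]
    exact h2

/-- An element of an ideal acting commutatively on a chief factor which is singular on the factor
annihilates it. -/
theorem IsChief.mem_rightAnnihilator_of_singular (hL : IsLeibniz L) (hA : IsAAlgebra F L)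
    (hsol : IsSolvable F L) {V U N : Submodule F L} (h : IsChief V U) (hN : IsIdeal N)
    (hNN : ∀ x ∈ N, ∀ y ∈ N, x * y ∈ rightAnnihilator V U) {x : L} (hx : x ∈ N)
    {u : L} (hu : u ∈ U) (huV : u ∉ V) (hux : u * x ∈ V) : x ∈ rightAnnihilator V U := by
  have hVx : ∀ v ∈ V, LinearMap.mulRight F x v ∈ V := fun v hv => h.bot_isIdeal.mul_mem_right v hv x
  -- On `U / V`, `x` commutes with every `z ∈ N`, as `z * x` acts trivially.
  have hcomm : ∀ n : ℕ, ∀ w ∈ U, (LinearMap.mulRight F x ^ n) w ∈ V → ∀ z ∈ N,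
      (LinearMap.mulRight F x ^ n) (w * z) ∈ V := by
    intro n
    induction n with
    | zero => exact fun w _ hw z _ => h.bot_isIdeal.mul_mem_right w hw z
    | succ n ih =>
      intro w hw hwV z hz
      rw [pow_succ, Module.End.mul_apply, LinearMap.mulRight_apply] at hwV ⊢
      rw [hL.mul_mul_right, map_add]
      exact add_mem (ih _ (h.top_isIdeal.mul_mem_right w hw x) hwV z hz)
        (pow_apply_mem hVx n (hNN z hz x hx w hw))
  -- From `(w * y) * x = (w * x) * y + w * (y * x)` with `y * x ∈ N`; one extra power of `x` makes
  -- the null component `E` stable under all of `L`.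
  have hstep : ∀ n : ℕ, ∀ w ∈ U, (LinearMap.mulRight F x ^ n) w ∈ V → ∀ y : L,
      (LinearMap.mulRight F x ^ (n + 1)) (w * y) ∈ V := by
    intro n
    induction n with
    | zero => exact fun w _ hw y => pow_apply_mem hVx 1 (h.bot_isIdeal.mul_mem_right w hw y)
    | succ n ih =>
      intro w hw hwV y
      have h1 := hcomm _ w hw hwV (y * x) (hN.mul_mem_left y x hx)
      rw [pow_succ, Module.End.mul_apply, LinearMap.mulRight_apply] at hwV ⊢
      rw [hL.mul_mul_right, map_add]
      exact add_mem (ih _ (h.top_isIdeal.mul_mem_right w hw x) hwV y) h1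
  let E : Submodule F L :=
    { carrier := {w | w ∈ U ∧ ∃ n : ℕ, (LinearMap.mulRight F x ^ n) w ∈ V}
      zero_mem' := ⟨zero_mem _, 0, by simp⟩
      add_mem' := by
        rintro a b ⟨ha, n, hn⟩ ⟨hb, m, hm⟩
        refine ⟨add_mem ha hb, max n m, ?_⟩
        rw [map_add]
        exact add_mem (pow_apply_mem_of_le hVx (le_max_left n m) hn)
          (pow_apply_mem_of_le hVx (le_max_right n m) hm)
      smul_mem' := by
        rintro c a ⟨ha, n, hn⟩
        exact ⟨U.smul_mem c ha, n, by rw [map_smul]; exact V.smul_mem c hn⟩ }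
  have hE : E = V ∨ E = U := h.eq_or_eq_of_right hL (fun v hv => ⟨h.lt.le hv, 0, hv⟩)
    (fun w hw => hw.1)
    (fun w hw y => ⟨h.top_isIdeal.mul_mem_right w hw.1 y, hw.2.imp' (· + 1)
      fun n hn => hstep n w hw.1 hn y⟩)
  have huE : u ∈ E := ⟨hu, 1, by simpa using hux⟩
  rcases hE with hE | hE
  · exact absurd (hE.le huE) huV
  · exact hA.mem_rightAnnihilator hL h.bot_isIdeal h.top_isIdeal (h.mul_mem hL hsol)
      fun w hw => (hE.ge hw).2

/-- An ideal acting commutatively on a chief factor induces an action of dimension at most one. -/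
theorem IsChief.exists_sub_smul_mem_rightAnnihilator [IsAlgClosed F] (hL : IsLeibniz L)
    (hA : IsAAlgebra F L) (hsol : IsSolvable F L) {V U N : Submodule F L} (h : IsChief V U)
    (hN : IsIdeal N) (hNN : ∀ x ∈ N, ∀ y ∈ N, x * y ∈ rightAnnihilator V U) :
    ∃ e ∈ N, ∀ x ∈ N, ∃ c : F, x - c • e ∈ rightAnnihilator V U := by
  by_cases hNK : N ≤ rightAnnihilator V U
  · exact ⟨0, zero_mem _, fun x hx => ⟨0, by simpa using hNK hx⟩⟩
  obtain ⟨e, he, heK⟩ := SetLike.not_le_iff_exists.1 hNK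
  refine ⟨e, he, fun x hx => ?_⟩
  have hU := h.top_isIdeal.mul_mem_right
  have hV := h.bot_isIdeal.mul_mem_right
  obtain ⟨c, u, hu, huV, huc⟩ := exists_sub_smul_mem h.lt (f := LinearMap.mulRight F x)
    (g := LinearMap.mulRight F e) (fun u hu => hU u hu x) (fun u hu => hV u hu x)
    (fun u hu => hU u hu e) (fun u hu => hV u hu e) fun u hu hue => by
      by_contra huV
      exact heK (h.mem_rightAnnihilator_of_singular hL hA hsol hN hNN he hu huV hue)
  refine ⟨c, h.mem_rightAnnihilator_of_singular hL hA hsol hN hNN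
    (sub_mem hx (N.smul_mem c he)) hu huV ?_⟩
  rw [mul_sub, mul_smul_comm]
  exact huc

/-- The second derived algebra annihilates every chief factor. -/
theorem IsChief.derivedSeries_two_le [IsAlgClosed F] (hL : IsLeibniz L)
    (hA : IsAAlgebra F L) (hsol : IsSolvable F L) {V U : Submodule F L} (h : IsChief V U) :
    derivedSeries F L 2 ≤ rightAnnihilator V U := by
  have hK : IsIdeal (rightAnnihilator V U) :=
    isIdeal_rightAnnihilator hL h.bot_isIdeal h.top_isIdeal
  generalize hKdef : rightAnnihilator V U = K at hK
  have hsymm : ∀ x y : L, x * y ∈ K → y * x ∈ K := by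
    intro x y hxy
    rw [← hKdef] at hxy ⊢
    intro u hu
    have h1 := neg_mem (hxy u hu)
    rw [hL, neg_sub] at h1
    rwa [hL]
  obtain ⟨N, ⟨hN, hKN, hNN⟩, hmax⟩ := exists_maximal_of_wellFoundedGT
    (fun N : Submodule F L => IsIdeal N ∧ K ≤ N ∧ ∀ x ∈ N, ∀ y ∈ N, x * y ∈ K)
    ⟨K, hK, le_rfl, fun x hx y _ => hK.mul_mem_right x hx y⟩
  obtain ⟨e, he, heN⟩ : ∃ e ∈ N, ∀ x ∈ N, ∃ c : F, x - c • e ∈ K := by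
    subst hKdef
    exact h.exists_sub_smul_mem_rightAnnihilator hL hA hsol hN hNN
  have hmod : ∀ y : L, ∃ c : F, e * y - c • e ∈ K := fun y => heN _ (hN.mul_mem_right e he y)
  let C : Submodule F L := K.comap (LinearMap.mulLeft F e)
  -- Scalars commute: if `e * x ≡ a • e` and `e * y ≡ b • e`, then `e * (x * y) ≡ (a * b - b * a) •
  -- e = 0` modulo `K`.
  have hprod : ∀ x y : L, x * y ∈ C := by
    intro x y
    change e * (x * y) ∈ K
    obtain ⟨a, ha⟩ := hmod x
    obtain ⟨b, hb⟩ := hmod y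
    have h1 := sub_mem (add_mem (hK.mul_mem_right _ ha y) (K.smul_mem a hb))
      (add_mem (hK.mul_mem_right _ hb x) (K.smul_mem b ha))
    rw [hL]
    convert h1 using 1
    simp only [sub_mul, smul_sub, smul_mul_assoc, smul_smul, mul_comm b a]
    abel
  have hC : IsIdeal C := ⟨fun x _ y => hprod x y, fun x y _ => hprod x y⟩
  have hNC : N ≤ C := fun x hx => hNN e he x hx
  have hCN : C = N := by
    by_contra hne
    obtain ⟨D, hDC, hD⟩ := exists_isChief_le hN hC (lt_of_le_of_ne hNC (Ne.symm hne))
    have hDD := hD.mul_mem hL hsol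
    have hND : ∀ x ∈ N, ∀ y ∈ D, x * y ∈ K := by
      intro x hx y hy
      obtain ⟨c, hc⟩ := heN x hx
      have h1 := add_mem (hK.mul_mem_right _ hc y) (K.smul_mem c (hDC hy))
      rw [sub_mul, smul_mul_assoc] at h1
      convert h1 using 1
      simp
    have hDK := hA.mul_mem_of_engel hL (S := D) (I := K)
      (fun x hx y _ => hD.top_isIdeal.mul_mem_right x hx y)
      (fun x hx y _ => hK.mul_mem_right x hx y) (fun x _ y hy => hK.mul_mem_left x y hy)
      -- `y * x ∈ N` and `N * D ⊆ K`, so two multiplications by `x` suffice.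
      fun x hx y hy => ⟨2, by
        rw [pow_two]; exact hND _ (hDD y hy x hx) x hx⟩
    exact hD.lt.not_ge (hmax ⟨hD.top_isIdeal, hKN.trans hD.lt.le, hDK⟩ hD.lt.le)
  have h1 : derivedSeries F L 1 ≤ N := bracket_le.2 fun u _ v _ => hCN ▸ hprod u v
  exact bracket_le.2 fun u hu v hv => hNN u (h1 hu) v (h1 hv)

theorem derivedSeries_three_eq_bot [IsAlgClosed F] (hL : IsLeibniz L)
    (hA : IsAAlgebra F L) (hsol : IsSolvable F L) : derivedSeries F L 3 = ⊥ := by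
  -- `M` is a maximal ideal among those on which `L^{(2)}` acts by nilpotent operators; a chief
  -- factor above `M` would enlarge it at the cost of one more power.
  obtain ⟨M, ⟨hM, hMn⟩, hmax⟩ := exists_maximal_of_wellFoundedGT
    (fun M : Submodule F L => IsIdeal M ∧ ∀ x ∈ derivedSeries F L 2, ∀ y ∈ M,
      ∃ n : ℕ, (LinearMap.mulRight F x ^ n) y = 0)
    ⟨⊥, ⟨by simp, by simp⟩, fun x _ y hy => ⟨0, by simpa using hy⟩⟩
  have hMtop : M = ⊤ := by
    by_contra hne
    obtain ⟨U, -, hU⟩ := exists_isChief_le hM (isIdeal_derivedSeries (F := F) hL 0)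
      (lt_top_iff_ne_top.2 hne)
    refine hU.lt.not_ge (hmax ⟨hU.top_isIdeal, fun x hx y hy => ?_⟩ hU.lt.le)
    obtain ⟨n, hn⟩ := hMn x hx (y * x) (hU.derivedSeries_two_le hL hA hsol hx y hy)
    exact ⟨n + 1, by rw [pow_succ]; exact hn⟩
  subst hMtop
  have hI := isIdeal_derivedSeries (F := F) hL 2
  exact eq_bot_iff.2 (bracket_le.2 fun u hu v hv => (Submodule.mem_bot F).2
    (hA.mul_eq_zero hL (fun x hx y _ => hI.mul_mem_right x hx y)
      (fun x hx y _ => hMn x hx y Submodule.mem_top) u hu v hv))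

end Main

end LeibnizAlgebra

theorem theorem7p1 {F : Type*} {L : Type*} [Field F] [IsAlgClosed F]
    [NonUnitalNonAssocRing L] [Module F L] [IsScalarTower F L L] [SMulCommClass F L L]
    [FiniteDimensional F L]
    (hLeibniz : LeibnizAlgebra.IsLeibniz L)
    (hA : LeibnizAlgebra.IsAAlgebra F L)
    (hSolvable : LeibnizAlgebra.IsSolvable F L) :
    LeibnizAlgebra.derivedLength F L ≤ 3 :=
  Nat.sInf_le (LeibnizAlgebra.derivedSeries_three_eq_bot hLeibniz hA hSolvable)
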